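/- Consider channel access in a stationary Markov environment. There are a finite set $\mathcal S$ of states and a finite set of $K$ channels; for each state $j$ let $\mathcal T_j$ be the set of channels that are idle in state $j$, and let $A_{j,a}=I_{\{a\in\mathcal T_j\}}$. Let $\mathbf P=(P_{s,j})$ be an irreducible stochastic matrix on $\mathcal S$ with stationary distribution $\boldsymbol\pi=\boldsymbol\pi\mathbf P$, and let $C_a\in\mathbb R$ be the expected reward for accessing an idle channel $a$. For each $s$ let $m_s\in\arg\max_{j}P_{s,j}$ be a most likely next state, and assume $\mathcal T_{m_s}\neq\emptyset$. Maximum-likelihood (ML) prediction and access with decision rule $q$ works as follows: at time $t$, in state $s_t=s$ (with arbitrary initial state), a channel $a_t=a\in\mathcal T_{m_s}$ is accessed with probability $q_s(a)$; then, whatever the past and the channel accessed, the next state $s_{t+1}$ is $j$ with probability $P_{s,j}$; the reward $r_t$ is uniformly bounded, and given the past, $a_t=a$ and $s_{t+1}=j$ it has conditional expectation $A_{j,a}C_a$ (that is, $C_a$ if $a$ is idle in state $j$, and $0$ otherwise). The limiting throughput is the almost sure limit $\mathrm{Thr}=\lim_{T\to\infty}\frac1T\sum_{t=1}^T r_t$,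 and the ML throughput expression is $$ \Theta(q)=\sum_{s\in\mathcal S}\pi_s\Big(P_{s,m_s}\sum_{a\in\mathcal T_{m_s}}q_s(a)C_a+\sum_{j\neq m_s}P_{s,j}\sum_{a\in\mathcal T_j\cap\mathcal T_{m_s}}q_s(a)C_a\Big). $$ 1. If $q_s(a)=I_{\{a=a^*(s)\}}$ with $a^*(s)\in\arg\max_{a\in\mathcal T_{m_s}}C_a$ (any choice of maximizers), then $\Theta(q)$ equals the following expression, and the limiting throughput exists almost surely and has the same value: $$ \mathrm{Thr}=\sum_{s\in\mathcal S}\pi_s\,\max_{a\in\mathcal T_{m_s}}C_a\cdot\Big(P_{s,m_s}+\sum_{j\neq m_s}P_{s,j}A_{j,a^*(s)}\Big). $$ 2. If $C_a=C$ for all $a$ and $q_s(a)=\frac{1}{|\mathcal T_{m_s}|}I_{\{a\in\mathcal T_{m_s}\}}$, then $\Theta(q)$ equals each of the following expressions, and the limiting throughput exists almost surely and has the same value: $$ \mathrm{Thr}=C\sum_{s\in\mathcal S}\pi_s\Big(P_{s,m_s}+\sum_{j\neq m_s}P_{s,j}\frac{|\mathcal T_j\cap\mathcal T_{m_s}|}{|\mathcal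 T_{m_s}|}\Big) =C\sum_{s,j\in\mathcal S}\pi_sP_{s,j}\frac{|\mathcal T_j\cap\mathcal T_{m_s}|}{|\mathcal T_{m_s}|} =C\sum_{s,j\in\mathcal S}\pi_sP_{s,j}\frac{\sum_{a=1}^K A_{j,a}A_{m_s,a}}{\sum_{a=1}^K A_{m_s,a}}. $$ -/

import Mathlib

open MeasureTheory ProbabilityTheory Filter Topology
open scoped Matrix

/-- Entry `(j, a)` of the 0-1 connectivity matrix: it is `1` when channel `a` is idle in state `j`
(that is, `a ∈ idle j`) and `0` otherwise. -/
def connectivity {S Ch : Type*} [DecidableEq Ch] (idle : S → Finset Ch) (j : S) (a : Ch) : ℝ :=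
  if a ∈ idle j then 1 else 0

/-- `π` is a stationary distribution of the transition matrix `P`: a probability vector with
`π = π P`. -/
def IsStationaryDistribution {S : Type*} [Fintype S] (P : Matrix S S ℝ) (π : S → ℝ) : Prop :=
  π ∈ stdSimplex ℝ S ∧ π ᵥ* P = π

/-- `m` predicts a most likely next state: `m s ∈ argmax_j P s j` (ties broken arbitrarily). -/
def IsMLPrediction {S : Type*} (P : Matrix S S ℝ) (m : S → S) : Prop :=
  ∀ s j, P s j ≤ P s (m s)

/-- `best s ∈ argmax_{a ∈ idle (m s)} C a` (ties broken arbitrarily): a channel of highest expected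
reward among those that are idle in the predicted state. -/
def IsBestPredictedChannel {S Ch : Type*} (m : S → S) (idle : S → Finset Ch) (C : Ch → ℝ)
    (best : S → Ch) : Prop :=
  ∀ s, best s ∈ idle (m s) ∧ ∀ a ∈ idle (m s), C a ≤ C (best s)

/-- The decision rule that accesses channel `best s` in state `s`. -/
def deterministicRule {S Ch : Type*} [DecidableEq Ch] (best : S → Ch) (s : S) (a : Ch) : ℝ :=
  if a = best s then 1 else 0

/-- The decision rule that, in state `s`, accesses a uniformly chosen channel among those that are
idle in the predicted state `m s`. -/
noncomputable def uniformRule {S Ch : Type*} [DecidableEq Ch] (m : S → S) (idle : S → Finset Ch)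
    (s : S) (a : Ch) : ℝ :=
  1 / ((idle (m s)).card : ℝ) * (if a ∈ idle (m s) then 1 else 0)

/-- The throughput expression of maximum-likelihood prediction and access, where in state `s`
channel `a ∈ idle (m s)` is accessed with probability `q s a`. -/
noncomputable def mlThroughput {S Ch : Type*} [Fintype S] [DecidableEq S] [DecidableEq Ch]
    (P : Matrix S S ℝ) (π : S → ℝ) (m : S → S) (idle : S → Finset Ch) (C : Ch → ℝ)
    (q : S → Ch → ℝ) : ℝ :=
  ∑ s, π s * (P s (m s) * ∑ a ∈ idle (m s), q s a * C a
    + ∑ j ∈ Finset.univ.erase (m s), P s j * ∑ a ∈ idle j ∩ idle (m s), q s a * C a)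

/-- Channel access in a stationary (non-reactive) Markov environment. At time `t` the environment
is in state `st t`, the user accesses channel `act t`, the environment moves to `st (t + 1)` and the
user collects the reward `r t`; `hist t` is the information available when `act t` is chosen.
The initial state is arbitrary. -/
structure IsAccessProcess {S Ch Ω : Type*} [MeasurableSpace S] [MeasurableSpace Ch]
    {mΩ : MeasurableSpace Ω} (μ : Measure Ω) (P : Matrix S S ℝ) (idle : S → Finset Ch)
    (C : Ch → ℝ) (q : S → Ch → ℝ) [DecidableEq Ch] (hist : Filtration ℕ mΩ)
    (st : ℕ → Ω → S) (act : ℕ → Ω → Ch) (r : ℕ → Ω → ℝ) : Prop where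
  measurable_st : ∀ t, Measurable[hist t] (st t)
  measurable_act : ∀ t, Measurable[hist (t + 1)] (act t)
  measurable_r : ∀ t, Measurable[hist (t + 1)] (r t)
  /-- In state `s`, channel `a` is chosen with probability `q s a`. -/
  policy : ∀ t a, μ⟦{ω | act t ω = a} | hist t⟧ =ᵐ[μ] fun ω => q (st t ω) a
  /-- The next state is drawn from the row of `P` given by the current state, whatever the action. -/
  transition : ∀ t j,
    μ⟦{ω | st (t + 1) ω = j} | hist t ⊔ MeasurableSpace.comap (act t) inferInstance⟧
      =ᵐ[μ] fun ω => P (st t ω) j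
  /-- Given the past, the action `a` and the next state `j`, the expected reward is `C a` if `a` is
  idle in state `j`, and `0` otherwise. -/
  reward : ∀ t,
    μ[r t | hist t ⊔ MeasurableSpace.comap (act t) inferInstance
        ⊔ MeasurableSpace.comap (st (t + 1)) inferInstance]
      =ᵐ[μ] fun ω => connectivity idle (st (t + 1) ω) (act t ω) * C (act t ω)
  /-- The numbers of bits delivered in one slot are uniformly bounded. -/
  bounded : ∃ B : ℝ, ∀ t, ∀ᵐ ω ∂μ, |r t ω| ≤ B

/-- The limiting throughput equals `v` almost surely. -/
def HasLimitingThroughput {Ω : Type*} {mΩ : MeasurableSpace Ω} (μ : Measure Ω) (r : ℕ → Ω → ℝ)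
    (v : ℝ) : Prop :=
  ∀ᵐ ω ∂μ, Tendsto (fun n : ℕ => 1 / (n : ℝ) * ∑ t ∈ Finset.Icc 1 n, r t ω) atTop (𝓝 v)

/-! Given the past, the mean of `r t` is a function f of the current state alone
(`IsAccessProcess.condExp_reward`). Irreducibility lets one solve the Poisson equation g - P g = f -
π·f (`exists_sub_mulVec_eq`). Then r_t + g(s_{t+1}) - g(s_t) - π·f is a bounded martingale
difference, so its averages vanish almost surely (`ae_tendsto_average_of_condExp_eq_zero`). The g
terms telescope to a bounded quantity, so the averages of r_t tend to π·f. Neither aperiodicity nor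
a stationary start is needed.

The rest is finite algebra: for a rule supported on the channels idle in the predicted state, Θ(q) =
π·f (`mlThroughput_eq_dotProduct`), and Θ is evaluated for the two rules. -/

/-- Kronecker's lemma with weights `t + 1`. -/
lemma tendsto_average_of_tendsto_sum_div {d : ℕ → ℝ} {l : ℝ}
    (h : Tendsto (fun n => ∑ t ∈ Finset.range n, d t / ((t : ℝ) + 1)) atTop (𝓝 l)) :
    Tendsto (fun n : ℕ => (n : ℝ)⁻¹ * ∑ t ∈ Finset.range n, d t) atTop (𝓝 0) := by
  set M : ℕ → ℝ := fun n => ∑ t ∈ Finset.range n, d t / ((t : ℝ) + 1) with hM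
  -- Summation by parts: after division by n, both `M n` and its Cesàro mean tend to `l`, so they
  -- cancel.
  have parts : ∀ n : ℕ, ∑ t ∈ Finset.range n, d t
      = n * M n - ∑ t ∈ Finset.range n, M t := by
    intro n
    induction n with
    | zero => simp
    | succ n ih =>
      have hs : M (n + 1) = M n + d n / ((n : ℝ) + 1) := Finset.sum_range_succ _ _
      rw [Finset.sum_range_succ, Finset.sum_range_succ, ih, hs]
      have : (n : ℝ) + 1 ≠ 0 := by positivity
      push_cast
      field_simp
      ring
  have hlim := h.sub h.cesaro
  rw [sub_self] at hlim
  refine hlim.congr' ?_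
  filter_upwards [eventually_ge_atTop 1] with n hn
  have : (n : ℝ) ≠ 0 := by positivity
  rw [parts]
  field_simp

/-! ### Strong law for bounded martingale differences -/

section MartingaleDifferences

variable {Ω : Type*} {mΩ : MeasurableSpace Ω} {μ : Measure Ω} [IsProbabilityMeasure μ]

lemma integrable_of_ae_abs_le {f : Ω → ℝ} (hf : AEStronglyMeasurable f μ) {B : ℝ}
    (hB : ∀ᵐ ω ∂μ, |f ω| ≤ B) : Integrable f μ :=
  .of_bound hf B (by simpa only [Real.norm_eq_abs] using hB)

lemma sum_inv_succ_sq_le (n : ℕ) :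
    ∑ t ∈ Finset.range n, 1 / ((t : ℝ) + 1) ^ 2 ≤ 2 := by
  -- Strengthened so that induction closes: 2/(n+1) - 2/(n+2) dominates 1/(n+1)².
  suffices h : ∑ t ∈ Finset.range n, 1 / ((t : ℝ) + 1) ^ 2 ≤ 2 - 2 / ((n : ℝ) + 1) by
    have : 0 ≤ 2 / ((n : ℝ) + 1) := by positivity
    linarith
  induction n with
  | zero => norm_num
  | succ n ih =>
    have step : 2 - 2 / ((n : ℝ) + 1 + 1) - (2 - 2 / ((n : ℝ) + 1)) - 1 / ((n : ℝ) + 1) ^ 2 =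
        n / (((n : ℝ) + 1) ^ 2 * ((n : ℝ) + 1 + 1)) := by
      field_simp
      ring
    have : 0 ≤ n / (((n : ℝ) + 1) ^ 2 * ((n : ℝ) + 1 + 1)) := by positivity
    rw [Finset.sum_range_succ]
    push_cast
    linarith

/-- Strong law of large numbers for bounded martingale differences. -/
theorem ae_tendsto_average_of_condExp_eq_zero {ℱ : Filtration ℕ mΩ} {D : ℕ → Ω → ℝ} {B : ℝ}
    (hD : ∀ t, StronglyMeasurable[ℱ (t + 1)] (D t)) (hB : ∀ t, ∀ᵐ ω ∂μ, |D t ω| ≤ B)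
    (hzero : ∀ t, μ[D t | ℱ t] =ᵐ[μ] 0) :
    ∀ᵐ ω ∂μ, Tendsto (fun n : ℕ => (n : ℝ)⁻¹ * ∑ t ∈ Finset.range n, D t ω) atTop (𝓝 0) := by
  -- The weights 1/(t+1) have summable squares, so this martingale is bounded in L² and converges;
  -- Kronecker's lemma then gives the averages.
  set M : ℕ → Ω → ℝ := fun n ω => ∑ t ∈ Finset.range n, D t ω / ((t : ℝ) + 1) with hM
  have hDm : ∀ t, AEStronglyMeasurable (D t) μ := fun t =>
    ((hD t).mono (ℱ.le _)).aestronglyMeasurable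
  have hDi : ∀ t, Integrable (D t) μ := fun t => integrable_of_ae_abs_le (hDm t) (hB t)
  have hMs : StronglyAdapted ℱ M := fun n =>
    Finset.stronglyMeasurable_fun_sum _ fun t ht =>
      ((hD t).mono (ℱ.mono (Finset.mem_range.1 ht))).mul_const _
  have hMb : ∀ n, ∀ᵐ ω ∂μ, ‖M n ω‖ ≤ n * B := by
    intro n
    filter_upwards [ae_all_iff.2 hB] with ω hω
    have hterm : ∀ t ∈ Finset.range n, ‖D t ω / ((t : ℝ) + 1)‖ ≤ B := by
      intro t _
      rw [norm_div, Real.norm_eq_abs, Real.norm_of_nonneg (by positivity)]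
      exact (div_le_self (abs_nonneg _) (by linarith [(Nat.cast_nonneg t : (0 : ℝ) ≤ t)])).trans
        (hω t)
    simpa using norm_sum_le_of_le _ hterm
  have hMm : ∀ n, AEStronglyMeasurable (M n) μ := fun n =>
    ((hMs n).mono (ℱ.le _)).aestronglyMeasurable
  have hMi : ∀ n, Integrable (M n) μ := fun n => .of_bound (hMm n) _ (hMb n)
  have hMDi : ∀ n, Integrable (M n * D n) μ := fun n =>
    (hDi n).bdd_mul (hMm n) (hMb n)
  have hMMi : ∀ n, Integrable (fun ω => M n ω * M n ω) μ := fun n =>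
    (hMi n).bdd_mul (hMm n) (hMb n)
  have hDDi : ∀ n, Integrable (fun ω => D n ω * D n ω) μ := fun n =>
    (hDi n).bdd_mul (hDm n) (hB n)
  have hsucc : ∀ n, M (n + 1) = M n + fun ω => ((n : ℝ) + 1)⁻¹ * D n ω := by
    intro n
    ext ω
    simp only [hM, Finset.sum_range_succ, Pi.add_apply]
    ring
  have hmart : Martingale M ℱ μ := by
    refine martingale_of_condExp_sub_eq_zero_nat hMs hMi fun n => ?_
    rw [hsucc, add_sub_cancel_left]
    filter_upwards [condExp_smul (μ := μ) ((n : ℝ) + 1)⁻¹ (D n) (ℱ n), hzero n] with ω h1 h2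
    refine Eq.trans h1 ?_
    simp [h2]
  -- Orthogonality of increments: `M n` is known at time `n` and pulls out of the conditional
  -- expectation.
  have hcross : ∀ n, ∫ ω, M n ω * D n ω ∂μ = 0 := by
    intro n
    have h := condExp_mul_of_stronglyMeasurable_left (hMs n) (hMDi n) (hDi n)
    rw [← integral_condExp (ℱ.le n) (f := fun ω => M n ω * D n ω)]
    refine integral_eq_zero_of_ae ?_
    filter_upwards [h, hzero n] with ω h1 h2
    refine Eq.trans h1 ?_
    simp [h2]
  have hsq : ∀ n, ∫ ω, M n ω * M n ω ∂μ
      ≤ B ^ 2 * ∑ t ∈ Finset.range n, 1 / ((t : ℝ) + 1) ^ 2 := by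
    intro n
    induction n with
    | zero => simp [hM]
    | succ n ih =>
      have hexp : ∀ ω, M (n + 1) ω * M (n + 1) ω = M n ω * M n ω
          + 2 * ((n : ℝ) + 1)⁻¹ * (M n ω * D n ω)
          + (((n : ℝ) + 1)⁻¹) ^ 2 * (D n ω * D n ω) := by
        intro ω
        rw [hsucc]
        simp only [Pi.add_apply]
        ring
      have hDD : ∫ ω, D n ω * D n ω ∂μ ≤ B ^ 2 := by
        have h : ∫ ω, D n ω * D n ω ∂μ ≤ ∫ _, B ^ 2 ∂μ := by
          refine integral_mono_ae (hDDi n) (integrable_const _) ?_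
          filter_upwards [hB n] with ω hω
          have := abs_le.1 hω
          show D n ω * D n ω ≤ B ^ 2
          nlinarith
        simpa using h
      have i2 : Integrable (fun ω => 2 * ((n : ℝ) + 1)⁻¹ * (M n ω * D n ω)) μ :=
        (hMDi n).const_mul _
      have i12 : Integrable (fun ω => M n ω * M n ω + 2 * ((n : ℝ) + 1)⁻¹ * (M n ω * D n ω)) μ :=
        (hMMi n).add i2
      have i3 : Integrable (fun ω => (((n : ℝ) + 1)⁻¹) ^ 2 * (D n ω * D n ω)) μ :=
        (hDDi n).const_mul _
      simp_rw [hexp]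
      rw [integral_add i12 i3, integral_add (hMMi n) i2, integral_const_mul,
        integral_const_mul, hcross, mul_zero, add_zero, Finset.sum_range_succ, mul_add]
      refine add_le_add ih ?_
      calc (((n : ℝ) + 1)⁻¹) ^ 2 * ∫ ω, D n ω * D n ω ∂μ
          ≤ (((n : ℝ) + 1)⁻¹) ^ 2 * B ^ 2 := by gcongr
        _ = B ^ 2 * (1 / ((n : ℝ) + 1) ^ 2) := by rw [inv_pow, one_div, mul_comm]
  -- The convergence theorem asks for an L¹ bound; |x| ≤ 1 + x² derives it from the L² bound.
  have hL1 : ∀ n, eLpNorm (M n) 1 μ ≤ (1 + B ^ 2 * 2).toNNReal := by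
    intro n
    rw [eLpNorm_one_eq_lintegral_enorm, ← ofReal_integral_norm_eq_lintegral_enorm (hMi n)]
    refine ENNReal.ofReal_le_ofReal ?_
    have h : ∫ ω, ‖M n ω‖ ∂μ ≤ ∫ ω, (1 + M n ω * M n ω) ∂μ := by
      refine integral_mono (hMi n).norm ((integrable_const _).add (hMMi n)) fun ω => ?_
      show |M n ω| ≤ 1 + M n ω * M n ω
      nlinarith [sq_nonneg (|M n ω| - 1), abs_mul_abs_self (M n ω), abs_nonneg (M n ω)]
    have h' : ∫ ω, (1 + M n ω * M n ω) ∂μ = 1 + ∫ ω, M n ω * M n ω ∂μ := by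
      rw [integral_add (integrable_const _) (hMMi n)]
      simp
    have := mul_le_mul_of_nonneg_left (sum_inv_succ_sq_le n) (sq_nonneg B)
    linarith [hsq n]
  filter_upwards [hmart.submartingale.exists_ae_tendsto_of_bdd hL1] with ω ⟨l, hl⟩
  exact tendsto_average_of_tendsto_sum_div hl

end MartingaleDifferences

/-! ### Harmonic functions and the Poisson equation -/

section PoissonEquation

variable {S : Type*} [Fintype S] [DecidableEq S] {P : Matrix S S ℝ}

/-- Harmonic functions of an irreducible stochastic matrix are constant. -/
lemma eq_of_mulVec_eq_self (hP : P ∈ Matrix.rowStochastic ℝ S) (hirr : P.IsIrreducible)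
    {g : S → ℝ} (hg : P *ᵥ g = g) (i j : S) : g i = g j := by
  rcases subsingleton_or_nontrivial S with _ | _
  · rw [Subsingleton.elim i j]
  have hpow : ∀ k, (P ^ k) *ᵥ g = g := by
    intro k
    induction k with
    | zero => simp
    | succ k ih => rw [pow_succ, ← Matrix.mulVec_mulVec, hg, ih]
  -- Maximum principle: g(s) is a P^k-average of values at most g(s), so every state of positive
  -- weight attains the maximum; irreducibility reaches each state for some k.
  obtain ⟨s, hs⟩ := Finite.exists_max g
  suffices h : ∀ j, g j = g s by rw [h i, h j]
  intro j
  obtain ⟨k, -, hk⟩ := (Matrix.isIrreducible_iff_exists_pow_pos hirr.nonneg).1 hirr s j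
  have hPk := pow_mem hP k
  have hsum : ∑ t, (P ^ k) s t * (g s - g t) = 0 := by
    have h1 : ∑ t, (P ^ k) s t * g t = g s := congrFun (hpow k) s
    simp_rw [mul_sub]
    rw [Finset.sum_sub_distrib, h1, ← Finset.sum_mul,
      Matrix.sum_row_of_mem_rowStochastic hPk, one_mul, sub_self]
  have h0 := (Finset.sum_eq_zero_iff_of_nonneg fun t _ =>
    mul_nonneg (hPk.1 s t) (sub_nonneg.2 (hs t))).1 hsum j (Finset.mem_univ j)
  rcases mul_eq_zero.1 h0 with h | h
  · exact absurd h hk.ne'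
  · linarith

/-- The Poisson equation of an irreducible stochastic matrix is solvable. -/
lemma exists_sub_mulVec_eq (hP : P ∈ Matrix.rowStochastic ℝ S) (hirr : P.IsIrreducible)
    {π : S → ℝ} (hπ : IsStationaryDistribution P π) (f : S → ℝ) :
    ∃ g : S → ℝ, ∀ s, g s - (P *ᵥ g) s = f s - π ⬝ᵥ f := by
  obtain ⟨⟨-, hsum⟩, hstat⟩ := hπ
  have hone : π ⬝ᵥ (1 : S → ℝ) = 1 := by simpa [dotProduct] using hsum
  -- The rank-one term removes the kernel of 1 - P, namely the constants. Since π N = π, a solution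
  -- of N g = f has π·g = π·f, so N g = f is the Poisson equation.
  set N : Matrix S S ℝ := 1 - P + Matrix.vecMulVec 1 π
  have hN : ∀ g, N *ᵥ g = g - P *ᵥ g + (π ⬝ᵥ g) • (1 : S → ℝ) := by
    intro g
    ext s
    simp [N, Matrix.add_mulVec, Matrix.sub_mulVec, Matrix.replicateRow_mulVec_eq_const]
  have hπN : ∀ g, π ⬝ᵥ (N *ᵥ g) = π ⬝ᵥ g := by
    intro g
    rw [hN, dotProduct_add, dotProduct_sub, Matrix.dotProduct_mulVec, hstat, sub_self, zero_add,
      dotProduct_smul, hone, smul_eq_mul, mul_one]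
  have hinj : Function.Injective N.mulVec := by
    refine (injective_iff_map_eq_zero N.mulVecLin).2 fun g hg => ?_
    replace hg : N *ᵥ g = 0 := hg
    have h0 : π ⬝ᵥ g = 0 := by rw [← hπN, hg, dotProduct_zero]
    have hPg : P *ᵥ g = g := by
      have h := hN g
      rw [hg, h0, zero_smul, add_zero] at h
      exact (sub_eq_zero.1 h.symm).symm
    ext s
    have hc : g = g s • (1 : S → ℝ) := by
      ext j
      simpa using eq_of_mulVec_eq_self hP hirr hPg j s
    rw [hc, dotProduct_smul, hone] at h0
    simpa using h0
  have hsurj := Matrix.mulVec_surjective_iff_isUnit.2 (Matrix.mulVec_injective_iff_isUnit.1 hinj)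
  obtain ⟨g, hg⟩ := hsurj f
  refine ⟨g, fun s => ?_⟩
  have h := congrFun (hN g) s
  rw [← hπN, hg] at h
  simp only [Pi.add_apply, Pi.sub_apply, Pi.smul_apply, Pi.one_apply, smul_eq_mul, mul_one] at h
  linarith

end PoissonEquation

/-! ### Conditional expectations and the ergodic theorem for rewards -/

section AccessProcess

/-- The expected reward of one slot that starts in state `s`. -/
def expectedReward {S Ch : Type*} [Fintype S] [Fintype Ch] [DecidableEq Ch]
    (P : Matrix S S ℝ) (idle : S → Finset Ch) (C : Ch → ℝ) (q : S → Ch → ℝ) (s : S) : ℝ :=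
  ∑ a, (∑ j, connectivity idle j a * C a * P s j) * q s a

/-- Freezing: the conditional law of `X` integrates out functions of `X` and of a variable `Y` that
is known. -/
lemma condExp_comp_of_condProb {Ω ι κ : Type*} {m mΩ : MeasurableSpace Ω} {μ : Measure Ω}
    [IsProbabilityMeasure μ] (hm : m ≤ mΩ)
    [Fintype ι] [MeasurableSpace ι] [MeasurableSingletonClass ι]
    [Finite κ] [MeasurableSpace κ] [MeasurableSingletonClass κ]
    {X : Ω → ι} (hX : Measurable X) {p : ι → Ω → ℝ}
    (hp : ∀ j, μ⟦{ω | X ω = j} | m⟧ =ᵐ[μ] p j)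
    {Y : Ω → κ} (hY : Measurable[m] Y) (φ : ι → κ → ℝ) :
    μ[fun ω => φ (X ω) (Y ω) | m] =ᵐ[μ] fun ω => ∑ j, φ j (Y ω) * p j ω := by
  have hXj : ∀ j, MeasurableSet {ω | X ω = j} := fun j => hX (measurableSet_singleton j)
  have hdecomp : (fun ω => φ (X ω) (Y ω)) = ∑ j, (fun ω => φ j (Y ω)) *
      {ω | X ω = j}.indicator (fun _ => (1 : ℝ)) := by
    classical
    ext ω
    simp [Finset.sum_apply, Set.indicator_apply]
  have hφ : ∀ j, StronglyMeasurable[m] fun ω => φ j (Y ω) := fun j =>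
    ((measurable_of_finite (φ j)).comp hY).stronglyMeasurable
  have hind : ∀ j, Integrable ({ω | X ω = j}.indicator (fun _ => (1 : ℝ))) μ := fun j =>
    (integrable_const _).indicator (hXj j)
  have hbound : ∀ j, ∃ c, ∀ ω, ‖φ j (Y ω)‖ ≤ c := fun j => by
    obtain ⟨c, hc⟩ := (Set.finite_range fun y => ‖φ j y‖).bddAbove
    exact ⟨c, fun ω => hc ⟨Y ω, rfl⟩⟩
  have hint : ∀ j, Integrable ((fun ω => φ j (Y ω)) *
      {ω | X ω = j}.indicator (fun _ => (1 : ℝ))) μ := fun j => by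
    obtain ⟨c, hc⟩ := hbound j
    exact (hind j).bdd_mul ((hφ j).mono hm).aestronglyMeasurable (ae_of_all _ hc)
  rw [hdecomp]
  refine (condExp_finsetSum (fun j _ => hint j) m).trans ?_
  have hpull : ∀ j, μ[(fun ω => φ j (Y ω)) * {ω | X ω = j}.indicator (fun _ => (1 : ℝ)) | m]
      =ᵐ[μ] fun ω => φ j (Y ω) * p j ω := fun j => by
    filter_upwards [condExp_mul_of_stronglyMeasurable_left (hφ j) (hint j) (hind j), hp j]
      with ω h1 h2
    rw [h1, Pi.mul_apply, h2]
  filter_upwards [ae_all_iff.2 hpull] with ω hω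
  simp [Finset.sum_apply, hω]

namespace IsAccessProcess

variable {S Ch Ω : Type*} [MeasurableSpace S] [DecidableEq Ch] [MeasurableSpace Ch]
    {mΩ : MeasurableSpace Ω} {μ : Measure Ω}
    {P : Matrix S S ℝ} {idle : S → Finset Ch} {C : Ch → ℝ} {q : S → Ch → ℝ}
    {hist : Filtration ℕ mΩ} {st : ℕ → Ω → S} {act : ℕ → Ω → Ch} {r : ℕ → Ω → ℝ}

lemma comap_act_le (h : IsAccessProcess μ P idle C q hist st act r) (t : ℕ) :
    hist t ⊔ MeasurableSpace.comap (act t) inferInstance ≤ hist (t + 1) :=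
  sup_le (hist.mono t.le_succ) (h.measurable_act t).comap_le

lemma comap_st_le (h : IsAccessProcess μ P idle C q hist st act r) (t : ℕ) :
    hist t ⊔ MeasurableSpace.comap (act t) inferInstance
      ⊔ MeasurableSpace.comap (st (t + 1)) inferInstance ≤ hist (t + 1) :=
  sup_le (h.comap_act_le t) (h.measurable_st (t + 1)).comap_le

end IsAccessProcess

variable {S Ch Ω : Type*}
    [Fintype S] [MeasurableSpace S] [MeasurableSingletonClass S]
    [DecidableEq Ch] [MeasurableSpace Ch]
    {mΩ : MeasurableSpace Ω} {μ : Measure Ω} [IsProbabilityMeasure μ]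
    {P : Matrix S S ℝ} {idle : S → Finset Ch} {C : Ch → ℝ} {q : S → Ch → ℝ}
    {hist : Filtration ℕ mΩ} {st : ℕ → Ω → S} {act : ℕ → Ω → Ch} {r : ℕ → Ω → ℝ}

namespace IsAccessProcess

lemma condExp_comp_st_succ (h : IsAccessProcess μ P idle C q hist st act r) (t : ℕ)
    (g : S → ℝ) :
    μ[fun ω => g (st (t + 1) ω) | hist t] =ᵐ[μ] fun ω => (P *ᵥ g) (st t ω) := by
  have hG := (h.comap_act_le t).trans (hist.le _)
  have hst := h.measurable_st t
  have h1 := condExp_comp_of_condProb hG ((h.measurable_st (t + 1)).mono (hist.le _) le_rfl)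
    (h.transition t) (hst.mono le_sup_left le_rfl) (fun j _ => g j)
  -- The transition law is given conditionally on the action too; the tower property drops to `hist
  -- t`, for which the result is already measurable.
  refine (condExp_condExp_of_le le_sup_left hG).symm.trans ((condExp_congr_ae h1).trans ?_)
  have hmeas : StronglyMeasurable[hist t] fun ω => ∑ j, g j * P (st t ω) j :=
    ((measurable_of_finite fun s => ∑ j, g j * P s j).comp hst).stronglyMeasurable
  obtain ⟨c, hc⟩ := (Set.finite_range fun s => ‖∑ j, g j * P s j‖).bddAbove
  rw [condExp_of_stronglyMeasurable (hist.le t) hmeas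
    (.of_bound (hmeas.mono (hist.le t)).aestronglyMeasurable c
      (ae_of_all _ fun ω => hc ⟨st t ω, rfl⟩))]
  refine ae_of_all _ fun ω => ?_
  simp [Matrix.mulVec, dotProduct, mul_comm]

variable [Fintype Ch] [MeasurableSingletonClass Ch]

/-- Tower property through three nested σ-algebras: average the reward, then the next state with the
action frozen, then the action with the current state frozen. -/
lemma condExp_reward (h : IsAccessProcess μ P idle C q hist st act r) (t : ℕ) :
    μ[r t | hist t] =ᵐ[μ] fun ω => expectedReward P idle C q (st t ω) := by
  have hG := (h.comap_act_le t).trans (hist.le _)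
  have hH := (h.comap_st_le t).trans (hist.le _)
  have hact : Measurable[hist t ⊔ MeasurableSpace.comap (act t) inferInstance] (act t) :=
    (comap_measurable (act t)).mono le_sup_right le_rfl
  have h1 := condExp_comp_of_condProb hG ((h.measurable_st (t + 1)).mono (hist.le _) le_rfl)
    (h.transition t) hact (fun j a => connectivity idle j a * C a)
  have h2 := condExp_comp_of_condProb (hist.le t) ((h.measurable_act t).mono (hist.le _) le_rfl)
    (h.policy t) (h.measurable_st t)
    (fun a s => ∑ j, connectivity idle j a * C a * P s j)
  have h3 : μ[r t | hist t ⊔ MeasurableSpace.comap (act t) inferInstance] =ᵐ[μ]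
      fun ω => ∑ j, connectivity idle j (act t ω) * C (act t ω) * P (st t ω) j :=
    (condExp_condExp_of_le le_sup_left hH).symm.trans
      ((condExp_congr_ae (h.reward t)).trans h1)
  exact (condExp_condExp_of_le le_sup_left hG).symm.trans ((condExp_congr_ae h3).trans h2)

/-- Ergodic theorem for the rewards: the limiting throughput is the stationary average of the
expected reward. -/
theorem hasLimitingThroughput [DecidableEq S] (h : IsAccessProcess μ P idle C q hist st act r)
    (hP : P ∈ Matrix.rowStochastic ℝ S) (hirr : P.IsIrreducible)
    {π : S → ℝ} (hπ : IsStationaryDistribution P π) :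
    HasLimitingThroughput μ r (π ⬝ᵥ expectedReward P idle C q) := by
  set θ := π ⬝ᵥ expectedReward P idle C q
  obtain ⟨g, hg⟩ := exists_sub_mulVec_eq hP hirr hπ (expectedReward P idle C q)
  obtain ⟨B, hB⟩ := h.bounded
  obtain ⟨b, hb⟩ : ∃ b, ∀ s, |g s| ≤ b := by
    obtain ⟨b, hb⟩ := (Set.finite_range fun s => |g s|).bddAbove
    exact ⟨b, fun s => hb ⟨s, rfl⟩⟩
  have hgm : ∀ t, StronglyMeasurable[hist t] fun ω => g (st t ω) := fun t =>
    ((measurable_of_finite g).comp (h.measurable_st t)).stronglyMeasurable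
  have hrm : ∀ t, StronglyMeasurable[hist (t + 1)] (r t) := fun t =>
    (h.measurable_r t).stronglyMeasurable
  have hgi : ∀ t, Integrable (fun ω => g (st t ω)) μ := fun t =>
    integrable_of_ae_abs_le ((hgm t).mono (hist.le _)).aestronglyMeasurable
      (ae_of_all _ fun ω => hb _)
  have hri : ∀ t, Integrable (r t) μ := fun t =>
    integrable_of_ae_abs_le ((hrm t).mono (hist.le _)).aestronglyMeasurable (hB t)
  -- The corrector g turns the centred reward into a martingale difference: its conditional mean is
  -- f + P g - g - θ, which is zero.
  set D : ℕ → Ω → ℝ := fun t =>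
    r t + (fun ω => g (st (t + 1) ω)) - (fun ω => g (st t ω)) - fun _ => θ
  have hDm : ∀ t, StronglyMeasurable[hist (t + 1)] (D t) := fun t =>
    (((hrm t).add (hgm (t + 1))).sub ((hgm t).mono (hist.mono t.le_succ))).sub
      stronglyMeasurable_const
  have hDb : ∀ t, ∀ᵐ ω ∂μ, |D t ω| ≤ B + b + b + |θ| := by
    intro t
    filter_upwards [hB t] with ω hω
    have h1 : |D t ω| ≤ |r t ω| + |g (st (t + 1) ω)| + |g (st t ω)| + |θ| :=
      (abs_sub _ _).trans (add_le_add_left ((abs_sub _ _).trans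
        (add_le_add_left (abs_add_le _ _) _)) _)
    linarith [hb (st t ω), hb (st (t + 1) ω)]
  have hD0 : ∀ t, μ[D t | hist t] =ᵐ[μ] 0 := by
    intro t
    filter_upwards [condExp_sub (((hri t).add (hgi (t + 1))).sub (hgi t))
        (integrable_const θ) (hist t),
      condExp_sub ((hri t).add (hgi (t + 1))) (hgi t) (hist t),
      condExp_add (hri t) (hgi (t + 1)) (hist t),
      h.condExp_reward t, h.condExp_comp_st_succ t g] with ω h1 h2 h3 h4 h5
    rw [h1, Pi.sub_apply, h2, Pi.sub_apply, h3, Pi.add_apply, h4, h5,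
      condExp_of_stronglyMeasurable (hist.le t) (hgm t) (hgi t), condExp_const (hist.le t)]
    have := hg (st t ω)
    simp only [Pi.zero_apply]
    linarith
  -- The averages start at t = 1, so the differences and the filtration are both shifted by one.
  let hist' : Filtration ℕ mΩ :=
    ⟨fun t => hist (t + 1), fun _ _ hst => hist.mono (Nat.succ_le_succ hst), fun _ => hist.le _⟩
  filter_upwards [ae_tendsto_average_of_condExp_eq_zero (ℱ := hist') (D := fun t => D (t + 1))
    (fun t => hDm (t + 1)) (fun t => hDb (t + 1)) (fun t => hD0 (t + 1))] with ω hω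
  have htel : ∀ n : ℕ, ∑ t ∈ Finset.range n, D (t + 1) ω
      = ∑ t ∈ Finset.Icc 1 n, r t ω + (g (st (n + 1) ω) - g (st 1 ω)) - n * θ := by
    intro n
    induction n with
    | zero => simp
    | succ n ih =>
      rw [Finset.sum_range_succ, ih, Finset.sum_Icc_succ_top (by omega)]
      simp only [D, Pi.sub_apply, Pi.add_apply]
      push_cast
      ring
  have hbd : Tendsto (fun n : ℕ => (n : ℝ)⁻¹ * (g (st (n + 1) ω) - g (st 1 ω))) atTop (𝓝 0) := by
    refine tendsto_inv_atTop_nhds_zero_nat.zero_mul_isBoundedUnder_le ?_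
    refine isBoundedUnder_of ⟨b + b, fun n => ?_⟩
    exact (abs_sub _ _).trans (add_le_add (hb _) (hb _))
  have hlim := (hω.sub hbd).add_const θ
  rw [sub_zero, zero_add] at hlim
  refine hlim.congr' ?_
  filter_upwards [eventually_ge_atTop 1] with n hn
  have : (n : ℝ) ≠ 0 := by positivity
  rw [htel]
  field_simp
  ring

end IsAccessProcess

end AccessProcess

/-! ### Evaluation of the throughput expression -/

section Throughput

lemma sum_connectivity {S Ch : Type*} [Fintype Ch] [DecidableEq Ch] (idle : S → Finset Ch)
    (j : S) : ∑ a, connectivity idle j a = (idle j).card := by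
  simp [connectivity]

lemma sum_connectivity_mul_connectivity {S Ch : Type*} [Fintype Ch] [DecidableEq Ch]
    (idle : S → Finset Ch) (i j : S) :
    ∑ a, connectivity idle i a * connectivity idle j a = (idle i ∩ idle j).card := by
  simp [connectivity, ← ite_and, ← Finset.mem_inter, Finset.inter_comm]

variable {S Ch : Type*} [Fintype S] [DecidableEq S] [DecidableEq Ch]
  {P : Matrix S S ℝ} {m : S → S} {idle : S → Finset Ch} {C : Ch → ℝ}

/-- For a rule that only accesses channels idle in the predicted state, the throughput expression is
the stationary average of the expected reward. -/
lemma mlThroughput_eq_dotProduct [Fintype Ch] (π : S → ℝ) {q : S → Ch → ℝ}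
    (hq : ∀ s, ∀ a ∉ idle (m s), q s a = 0) :
    mlThroughput P π m idle C q = π ⬝ᵥ expectedReward P idle C q := by
  unfold mlThroughput expectedReward dotProduct
  refine Finset.sum_congr rfl fun s _ => ?_
  have hinter : ∀ j, ∑ a ∈ idle j ∩ idle (m s), q s a * C a
      = ∑ a, connectivity idle j a * (q s a * C a) := by
    intro j
    rw [← Finset.sum_subset (Finset.subset_univ (idle j ∩ idle (m s)))]
    · refine Finset.sum_congr rfl fun a ha => ?_
      simp [connectivity, (Finset.mem_inter.1 ha).1]
    · intro a _ ha
      by_cases haj : a ∈ idle j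
      · simp [hq s a fun h => ha (Finset.mem_inter.2 ⟨haj, h⟩)]
      · simp [connectivity, haj]
  -- Gives the predicted state the same form as the others, so that it joins the sum over `j`.
  have hself : ∑ a ∈ idle (m s), q s a * C a
      = ∑ a ∈ idle (m s) ∩ idle (m s), q s a * C a := by rw [Finset.inter_self]
  rw [hself, Finset.add_sum_erase Finset.univ
    (fun j => P s j * ∑ a ∈ idle j ∩ idle (m s), q s a * C a) (Finset.mem_univ _)]
  congr 1
  simp_rw [hinter, Finset.mul_sum, Finset.sum_mul]
  rw [Finset.sum_comm]
  refine Finset.sum_congr rfl fun a _ => Finset.sum_congr rfl fun j _ => ?_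
  ring

lemma mlThroughput_deterministicRule (π : S → ℝ) (hidle : ∀ s, (idle (m s)).Nonempty)
    {best : S → Ch} (hbest : IsBestPredictedChannel m idle C best) :
    mlThroughput P π m idle C (deterministicRule best)
      = ∑ s, π s * (idle (m s)).sup' (hidle s) C *
          (P s (m s) + ∑ j ∈ Finset.univ.erase (m s), P s j * connectivity idle j (best s)) := by
  unfold mlThroughput
  refine Finset.sum_congr rfl fun s _ => ?_
  have hsup : (idle (m s)).sup' (hidle s) C = C (best s) :=
    le_antisymm (Finset.sup'_le _ _ (hbest s).2) (Finset.le_sup' C (hbest s).1)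
  have hsum : ∀ A : Finset Ch, ∑ a ∈ A, deterministicRule best s a * C a
      = if best s ∈ A then C (best s) else 0 := fun A => by
    simp [deterministicRule]
  simp_rw [hsup, hsum, Finset.mem_inter, (hbest s).1, and_true, if_true, mul_assoc, mul_add,
    Finset.mul_sum]
  congr 1
  · ring
  · refine Finset.sum_congr rfl fun j _ => ?_
    unfold connectivity
    split_ifs <;> ring

lemma mlThroughput_uniformRule (π : S → ℝ) (hidle : ∀ s, (idle (m s)).Nonempty)
    {c : ℝ} (hC : ∀ a, C a = c) :
    mlThroughput P π m idle C (uniformRule m idle)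
      = c * ∑ s, π s * (P s (m s) + ∑ j ∈ Finset.univ.erase (m s),
          P s j * (((idle j ∩ idle (m s)).card : ℝ) / ((idle (m s)).card : ℝ))) := by
  unfold mlThroughput
  rw [Finset.mul_sum]
  refine Finset.sum_congr rfl fun s _ => ?_
  have hcard : ((idle (m s)).card : ℝ) ≠ 0 := by simpa using (hidle s).ne_empty
  have hsum : ∀ A ⊆ idle (m s), ∑ a ∈ A, uniformRule m idle s a * C a
      = c * ((A.card : ℝ) / ((idle (m s)).card : ℝ)) := fun A hA => by
    have : ∀ a ∈ A, uniformRule m idle s a * C a = c * (1 / ((idle (m s)).card : ℝ)) :=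
      fun a ha => by rw [uniformRule, if_pos (hA ha), hC]; ring
    rw [Finset.sum_congr rfl this, Finset.sum_const, nsmul_eq_mul]
    ring
  simp_rw [hsum _ Finset.Subset.rfl, hsum _ Finset.inter_subset_right, div_self hcard, mul_add,
    Finset.mul_sum]
  congr 1
  · ring
  · exact Finset.sum_congr rfl fun j _ => by ring

/-- The ratio equals 1 at j = `m s`, so the separate term is the missing summand; nonemptiness
excludes 0/0, which would be 0. -/
lemma sum_predicted_add_eq_sum (π : S → ℝ) (hidle : ∀ s, (idle (m s)).Nonempty) :
    ∑ s, π s * (P s (m s) + ∑ j ∈ Finset.univ.erase (m s),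
          P s j * (((idle j ∩ idle (m s)).card : ℝ) / ((idle (m s)).card : ℝ)))
      = ∑ s, ∑ j, π s * P s j *
          (((idle j ∩ idle (m s)).card : ℝ) / ((idle (m s)).card : ℝ)) := by
  refine Finset.sum_congr rfl fun s _ => ?_
  have hcard : ((idle (m s)).card : ℝ) ≠ 0 := by simpa using (hidle s).ne_empty
  simp_rw [mul_assoc]
  rw [← Finset.mul_sum, ← Finset.add_sum_erase Finset.univ _ (Finset.mem_univ (m s)),
    Finset.inter_self, div_self hcard, mul_one]

end Throughput

theorem mainTheorem5 {S Ch Ω : Type*}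
    [Fintype S] [DecidableEq S] [MeasurableSpace S] [MeasurableSingletonClass S]
    [Fintype Ch] [DecidableEq Ch] [MeasurableSpace Ch] [MeasurableSingletonClass Ch]
    {mΩ : MeasurableSpace Ω} (μ : Measure Ω) [IsProbabilityMeasure μ]
    (P : Matrix S S ℝ) (hP : P ∈ Matrix.rowStochastic ℝ S) (hirr : P.IsIrreducible)
    (π : S → ℝ) (hπ : IsStationaryDistribution P π)
    (idle : S → Finset Ch) (C : Ch → ℝ)
    (m : S → S) (hm : IsMLPrediction P m) (hidle : ∀ s, (idle (m s)).Nonempty)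
    (hist : Filtration ℕ mΩ) (st : ℕ → Ω → S) (act : ℕ → Ω → Ch) (r : ℕ → Ω → ℝ) :
    -- deterministic access of a best channel among those idle in the predicted state
    (∀ best : S → Ch, IsBestPredictedChannel m idle C best →
      mlThroughput P π m idle C (deterministicRule best)
          = ∑ s, π s * (idle (m s)).sup' (hidle s) C *
              (P s (m s) + ∑ j ∈ Finset.univ.erase (m s),
                P s j * connectivity idle j (best s)) ∧
      (IsAccessProcess μ P idle C (deterministicRule best) hist st act r →
        HasLimitingThroughput μ r
          (∑ s, π s * (idle (m s)).sup' (hidle s) C *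
              (P s (m s) + ∑ j ∈ Finset.univ.erase (m s),
                P s j * connectivity idle j (best s))))) ∧
    -- equal rewards and uniform access of the channels idle in the predicted state
    (∀ c : ℝ, (∀ a, C a = c) →
      mlThroughput P π m idle C (uniformRule m idle)
          = c * ∑ s, π s * (P s (m s) + ∑ j ∈ Finset.univ.erase (m s),
              P s j * (((idle j ∩ idle (m s)).card : ℝ) / ((idle (m s)).card : ℝ))) ∧
      mlThroughput P π m idle C (uniformRule m idle)
          = c * ∑ s, ∑ j, π s * P s j *
              (((idle j ∩ idle (m s)).card : ℝ) / ((idle (m s)).card : ℝ)) ∧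
      mlThroughput P π m idle C (uniformRule m idle)
          = c * ∑ s, ∑ j, π s * P s j *
              ((∑ a, connectivity idle j a * connectivity idle (m s) a)
                / ∑ a, connectivity idle (m s) a) ∧
      (IsAccessProcess μ P idle C (uniformRule m idle) hist st act r →
        HasLimitingThroughput μ r
          (c * ∑ s, ∑ j, π s * P s j *
              (((idle j ∩ idle (m s)).card : ℝ) / ((idle (m s)).card : ℝ))))) := by
  refine ⟨fun best hbest => ?_, fun c hC => ?_⟩
  · have hΘ := mlThroughput_deterministicRule (P := P) π hidle hbest
    refine ⟨hΘ, fun h => ?_⟩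
    rw [← hΘ, mlThroughput_eq_dotProduct π (q := deterministicRule best) fun s a ha =>
      if_neg fun (hab : a = best s) => ha (hab ▸ (hbest s).1)]
    exact h.hasLimitingThroughput hP hirr hπ
  · have hΘ := mlThroughput_uniformRule (P := P) π hidle hC
    have hΘ' := hΘ.trans (congrArg (c * ·) (sum_predicted_add_eq_sum π hidle))
    refine ⟨hΘ, hΘ', ?_, fun h => ?_⟩
    · simp_rw [sum_connectivity, sum_connectivity_mul_connectivity]
      exact hΘ'
    · refine hΘ' ▸ ?_
      rw [mlThroughput_eq_dotProduct π fun s a ha => by simp [uniformRule, ha]]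
      exact h.hasLimitingThroughput hP hirr hπ
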